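/- Let $B$ be a unital C*-algebra. For positive integers $m,k$, call operators $P_{a|x}$ ($a=1,\dots,k$, $x=1,\dots,m$) in a unital C*-algebra PVM elements if $P_{a|x}=P_{a|x}^*=P_{a|x}^2$ for all $a,x$ and $\sum_{a=1}^k P_{a|x}=\mathbb 1$ for every $x$. A state is a positive linear functional taking the value $1$ at $\mathbb 1$. Let $\mathbf{qA}(m,k,B)$ be the set of all families $\{\sigma_{a|x}\}_{a,x}$ of positive functionals on $B$ for which there are a Hilbert space $H$, PVM elements $P_{a|x}\in B(H)$ and a state $\phi$ on the minimal tensor product $B(H)\otimes_{\min}B$ with $\sigma_{a|x}(b)=\phi(P_{a|x}\otimes b)$ for all $a,x$ and $b\in B$ (quantum tensor assemblages). Let $\mathbf{qcA}(m,k,B)$ be the set of all families $\{\sigma_{a|x}\}_{a,x}$ of positive functionals on $B$ for which there are a Hilbert space $H$, a unital inclusion $B\subset B(H)$, PVM elements $P_{a|x}\in B'\subset B(H)$ in the commutant of $B$ and a state $\phi$ on $B(H)$ with $\sigma_{a|x}(b)=\phi(P_{a|x}b)$ for all $a,x$ and $b\in B$ (quantum commuting assemblages). Then $\mathbf{qA}(2,2,B)=\mathbf{qcA}(2,2,B)$.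 -/

import Mathlib

universe u

noncomputable section

namespace Steering

open scoped TensorProduct ComplexOrder

/-- A positive linear functional on a unital C⋆-algebra: positive elements are exactly the
elements `a⋆ a`. -/
def IsPositiveFunctional {A : Type*} [Ring A] [StarRing A] [Algebra ℂ A]
    (φ : A →ₗ[ℂ] ℂ) : Prop :=
  ∀ a : A, 0 ≤ φ (star a * a)

/-- A state: a positive linear functional `φ` with `φ 1 = 1`. -/
structure IsState {A : Type*} [Ring A] [StarRing A] [Algebra ℂ A] (φ : A →ₗ[ℂ] ℂ) : Prop where
  positive : IsPositiveFunctional φ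
  map_one : φ 1 = 1

/-- `P x a`, `x = 1, …, m`, `a = 1, …, k`, are the elements of `m` projection valued measures with
`k` outcomes each. -/
structure IsPVM {A : Type*} [Ring A] [StarRing A] {m k : ℕ} (P : Fin m → Fin k → A) : Prop where
  isStarProjection : ∀ x a, IsStarProjection (P x a)
  sum_eq_one : ∀ x, ∑ a, P x a = 1

section MinimalTensorProduct

variable {H K : Type*} [NormedAddCommGroup H] [InnerProductSpace ℂ H]
  [NormedAddCommGroup K] [InnerProductSpace ℂ K]

variable (H K) in
/-- The Hilbert space tensor product of `H` and `K`: the completion of the algebraic tensor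
product for the inner product `⟪x ⊗ y, x' ⊗ y'⟫ = ⟪x, x'⟫ ⟪y, y'⟫`. -/
def HilbertTensor : Type _ := UniformSpace.Completion (H ⊗[ℂ] K)

instance : NormedAddCommGroup (HilbertTensor H K) :=
  inferInstanceAs (NormedAddCommGroup (UniformSpace.Completion (H ⊗[ℂ] K)))

instance : InnerProductSpace ℂ (HilbertTensor H K) :=
  inferInstanceAs (InnerProductSpace ℂ (UniformSpace.Completion (H ⊗[ℂ] K)))

instance : CompleteSpace (HilbertTensor H K) :=
  inferInstanceAs (CompleteSpace (UniformSpace.Completion (H ⊗[ℂ] K)))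

variable (H K) in
/-- The isometric inclusion of the algebraic tensor product, with dense range. -/
def HilbertTensor.of : H ⊗[ℂ] K →ₗᵢ[ℂ] HilbertTensor H K :=
  UniformSpace.Completion.toComplₗᵢ

/-- The bounded operator `S ⊗ T` on the Hilbert space tensor product, the continuous extension of
`x ⊗ y ↦ S x ⊗ T y`. -/
def opTensor (S : H →L[ℂ] H) (T : K →L[ℂ] K) : HilbertTensor H K →L[ℂ] HilbertTensor H K :=
  ((TensorProduct.mapL S T).completion :
    UniformSpace.Completion (H ⊗[ℂ] K) →L[ℂ] UniformSpace.Completion (H ⊗[ℂ] K))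

theorem opTensor_of_tmul (S : H →L[ℂ] H) (T : K →L[ℂ] K) (x : H) (y : K) :
    opTensor S T (HilbertTensor.of H K (x ⊗ₜ[ℂ] y)) = HilbertTensor.of H K (S x ⊗ₜ[ℂ] T y) :=
  ContinuousLinearMap.completion_apply_coe (TensorProduct.mapL S T) (x ⊗ₜ[ℂ] y)

variable [CompleteSpace K] {B : Type*} [CStarAlgebra B]

/-- The minimal (spatial) tensor product `B(H) ⊗_min B`, where the C⋆-algebra `B` is included in
`B(K)` by means of the faithful unital representation `π`: the C⋆-subalgebra of `B(H ⊗ K)`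
generated by the operators `S ⊗ π b`. Up to the canonical isomorphism it does not depend on the
choice of the faithful representation `π`. -/
def minTensor (H : Type*) [NormedAddCommGroup H] [InnerProductSpace ℂ H]
    (π : B →⋆ₐ[ℂ] (K →L[ℂ] K)) :
    StarSubalgebra ℂ (HilbertTensor H K →L[ℂ] HilbertTensor H K) :=
  (StarAlgebra.adjoin ℂ
    (Set.range fun p : (H →L[ℂ] H) × B => opTensor p.1 (π p.2))).topologicalClosure

/-- The elementary tensor `S ⊗ b` of `B(H) ⊗_min B`. -/
def minTensor.tmul (π : B →⋆ₐ[ℂ] (K →L[ℂ] K)) (S : H →L[ℂ] H) (b : B) : minTensor H π :=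
  ⟨opTensor S (π b), StarSubalgebra.le_topologicalClosure _
    (StarAlgebra.subset_adjoin ℂ _ ⟨(S, b), rfl⟩)⟩

end MinimalTensorProduct

/-- The set `qA(m, k, B)` of quantum tensor assemblages on `B`: the families of positive
functionals `σ_{a|x} = φ (P_{a|x} ⊗ ·)` for a Hilbert space `H`, projection valued measures
`P_{a|x}` in `B(H)` and a state `φ` on `B(H) ⊗_min B`. -/
def qA (m k : ℕ) (B : Type u) [CStarAlgebra B] : Set (Fin m → Fin k → (B →ₗ[ℂ] ℂ)) :=
  {σ | (∀ x a, IsPositiveFunctional (σ x a)) ∧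
    ∃ (H : Type u) (_ : NormedAddCommGroup H) (_ : InnerProductSpace ℂ H) (_ : CompleteSpace H)
      (K : Type u) (_ : NormedAddCommGroup K) (_ : InnerProductSpace ℂ K) (_ : CompleteSpace K)
      (π : B →⋆ₐ[ℂ] (K →L[ℂ] K)) (P : Fin m → Fin k → (H →L[ℂ] H))
      (φ : minTensor H π →ₗ[ℂ] ℂ),
      Function.Injective π ∧ IsPVM P ∧ IsState φ ∧
        ∀ x a b, σ x a b = φ (minTensor.tmul π (P x a) b)}

/-- The set `qcA(m, k, B)` of quantum commuting assemblages on `B`: the families of positive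
functionals `σ_{a|x} = φ (P_{a|x} ·)` for a unital inclusion `π` of `B` in some `B(H)`, projection
valued measures `P_{a|x}` in the commutant of `B`, and a state `φ` on `B(H)`. -/
def qcA (m k : ℕ) (B : Type u) [CStarAlgebra B] : Set (Fin m → Fin k → (B →ₗ[ℂ] ℂ)) :=
  {σ | (∀ x a, IsPositiveFunctional (σ x a)) ∧
    ∃ (H : Type u) (_ : NormedAddCommGroup H) (_ : InnerProductSpace ℂ H) (_ : CompleteSpace H)
      (π : B →⋆ₐ[ℂ] (H →L[ℂ] H)) (P : Fin m → Fin k → (H →L[ℂ] H))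
      (φ : (H →L[ℂ] H) →ₗ[ℂ] ℂ),
      Function.Injective π ∧ IsPVM P ∧ (∀ x a, P x a ∈ Set.centralizer (Set.range π)) ∧
        IsState φ ∧ ∀ x a b, σ x a b = φ (P x a * π b)}

end Steering

end

/-! A tensor assemblage is a commuting one for any `m`, `k`: `P ⊗ 1` commutes with `1 ⊗ π b`, and a
state on the closed star subalgebra `B(H) ⊗_min B` extends to `B(H ⊗ K)`
(`IsState.exists_extension`).

The converse rests on amenability of the infinite dihedral group `ℤ/2 * ℤ/2`. Two binary PVMs amount
to two self-adjoint unitaries `U x = P x 0 - P x 1`, here commuting with `π b`. On `ℓ²(ℕ)` let `S x`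
permute the basis by the two reflections of the half-line that flip alternate edges, and let `W j`
be the alternating word of length `j` in the `U x`. With `V y = ∑ j < N, e j ⊗ W j y`, the
compression `V⋆ (S x ⊗ π b) V` is a sum of terms `W (σ j)⋆ π b W j`, where `σ` is the reflection.
Each equals `U x * π b` apart from boundary effects at the two ends of the interval
(`star_altWord_pairFlip_mul`). After division by `N` these vanish as `N → ∞`
(`tendsto_averageFunctional`), so a limit of the states `φ (V⋆ · V) / N` reproduces the assemblage
with the PVMs of `S x`. -/

noncomputable section

namespace Steering

open Filter Topology
open scoped TensorProduct ComplexOrder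

/-! ### Algebra of the operators `S ⊗ T`. -/

section OpTensor

variable {H K : Type*} [NormedAddCommGroup H] [InnerProductSpace ℂ H]
  [NormedAddCommGroup K] [InnerProductSpace ℂ K]

/-- Continuous linear maps on the Hilbert space tensor product that agree on elementary tensors
are equal. -/
theorem HilbertTensor.ext {E : Type*} [NormedAddCommGroup E] [NormedSpace ℂ E]
    {S T : HilbertTensor H K →L[ℂ] E}
    (h : ∀ x y, S (HilbertTensor.of H K (x ⊗ₜ[ℂ] y)) = T (HilbertTensor.of H K (x ⊗ₜ[ℂ] y))) :
    S = T := by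
  have hd : DenseRange (HilbertTensor.of H K) := UniformSpace.Completion.denseRange_coe
  refine ContinuousLinearMap.coeFn_injective
    (hd.equalizer S.continuous T.continuous (funext fun z => ?_))
  induction z using TensorProduct.induction_on with
  | zero => simp
  | tmul x y => exact h x y
  | add z w hz hw => simpa using congrArg₂ (· + ·) hz hw

theorem HilbertTensor.inner_of_tmul (x x' : H) (y y' : K) :
    inner ℂ (HilbertTensor.of H K (x ⊗ₜ[ℂ] y)) (HilbertTensor.of H K (x' ⊗ₜ[ℂ] y')) =
      inner ℂ x x' * inner ℂ y y' := by
  rw [LinearIsometry.inner_map_map, TensorProduct.inner_tmul]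

theorem opTensor_add_left (S S' : H →L[ℂ] H) (T : K →L[ℂ] K) :
    opTensor (S + S') T = opTensor S T + opTensor S' T :=
  HilbertTensor.ext fun x y => by simp [opTensor_of_tmul, TensorProduct.add_tmul]

theorem opTensor_add_right (S : H →L[ℂ] H) (T T' : K →L[ℂ] K) :
    opTensor S (T + T') = opTensor S T + opTensor S T' :=
  HilbertTensor.ext fun x y => by simp [opTensor_of_tmul, TensorProduct.tmul_add]

theorem opTensor_smul_left (c : ℂ) (S : H →L[ℂ] H) (T : K →L[ℂ] K) :
    opTensor (c • S) T = c • opTensor S T :=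
  HilbertTensor.ext fun x y => by simp [opTensor_of_tmul, ← TensorProduct.smul_tmul']

theorem opTensor_smul_right (c : ℂ) (S : H →L[ℂ] H) (T : K →L[ℂ] K) :
    opTensor S (c • T) = c • opTensor S T :=
  HilbertTensor.ext fun x y => by simp [opTensor_of_tmul]

@[simp]
theorem opTensor_one : opTensor (1 : H →L[ℂ] H) (1 : K →L[ℂ] K) = 1 :=
  HilbertTensor.ext fun x y => by simp [opTensor_of_tmul]

theorem opTensor_mul (S S' : H →L[ℂ] H) (T T' : K →L[ℂ] K) :
    opTensor S T * opTensor S' T' = opTensor (S * S') (T * T') :=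
  HilbertTensor.ext fun x y => by simp [opTensor_of_tmul]

theorem star_opTensor [CompleteSpace H] [CompleteSpace K] (S : H →L[ℂ] H) (T : K →L[ℂ] K) :
    star (opTensor S T) = opTensor (star S) (star T) := by
  symm
  rw [ContinuousLinearMap.star_eq_adjoint]
  refine HilbertTensor.ext fun x y => ?_
  refine (innerSL_inj (𝕜 := ℂ)).1 (HilbertTensor.ext fun x' y' => ?_)
  simp only [innerSL_apply_apply, ContinuousLinearMap.adjoint_inner_left, opTensor_of_tmul,
    HilbertTensor.inner_of_tmul, ContinuousLinearMap.star_eq_adjoint]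

/-- The inclusion `T ↦ 1 ⊗ T` of `B(K)` in `B(H ⊗ K)`. -/
def oneTensor (H K : Type*) [NormedAddCommGroup H] [InnerProductSpace ℂ H]
    [NormedAddCommGroup K] [InnerProductSpace ℂ K] [CompleteSpace H] [CompleteSpace K] :
    (K →L[ℂ] K) →⋆ₐ[ℂ] (HilbertTensor H K →L[ℂ] HilbertTensor H K) where
  toFun T := opTensor 1 T
  map_one' := opTensor_one
  map_mul' S T := by simp [opTensor_mul]
  map_zero' := by simpa using opTensor_smul_right (0 : ℂ) (1 : H →L[ℂ] H) (0 : K →L[ℂ] K)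
  map_add' := opTensor_add_right 1
  commutes' c := by simp [Algebra.algebraMap_eq_smul_one, opTensor_smul_right]
  map_star' T := by simp [star_opTensor]

theorem oneTensor_injective [CompleteSpace H] [CompleteSpace K] [Nontrivial H] :
    Function.Injective (oneTensor H K) := by
  refine (injective_iff_map_eq_zero _).2 fun T hT => ?_
  obtain ⟨x, hx⟩ := exists_ne (0 : H)
  ext y
  have h : opTensor 1 T (HilbertTensor.of H K (x ⊗ₜ[ℂ] y)) = 0 :=
    DFunLike.congr_fun (F := HilbertTensor H K →L[ℂ] HilbertTensor H K) hT _
  rw [opTensor_of_tmul, ← norm_eq_zero, LinearIsometry.norm_map, TensorProduct.norm_tmul] at h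
  simpa [hx] using h

theorem opTensor_isPVM [CompleteSpace H] [CompleteSpace K] {m k : ℕ}
    {P : Fin m → Fin k → (H →L[ℂ] H)} (hP : IsPVM P) :
    IsPVM fun x a => opTensor (P x a) (1 : K →L[ℂ] K) where
  isStarProjection x a := by
    have h := hP.isStarProjection x a
    exact ⟨by simp [IsIdempotentElem, opTensor_mul, h.isIdempotentElem.eq],
      by simp [IsSelfAdjoint, star_opTensor, h.isSelfAdjoint.star_eq]⟩
  sum_eq_one x := by
    let F : (H →L[ℂ] H) →+ (HilbertTensor H K →L[ℂ] HilbertTensor H K) :=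
      AddMonoidHom.mk' (fun S => opTensor S 1) fun S S' => opTensor_add_left S S' 1
    change ∑ a, F (P x a) = 1
    rw [← map_sum, hP.sum_eq_one]
    exact opTensor_one

end OpTensor

/-! ### Extension of states from closed star subalgebras. -/

section Extension

theorem IsPositiveFunctional.nonneg {A : Type*} [CStarAlgebra A] [PartialOrder A]
    [StarOrderedRing A] {φ : A →ₗ[ℂ] ℂ} (hφ : IsPositiveFunctional φ) {a : A} (ha : 0 ≤ a) :
    0 ≤ φ a := by
  obtain ⟨s, rfl⟩ := CStarAlgebra.nonneg_iff_eq_star_mul_self.1 ha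
  exact hφ s

/-- Closedness puts the square root of `a` in `M`, so positivity in the larger algebra `A` gives the
form `s⋆ s` with `s ∈ M`. -/
theorem IsPositiveFunctional.nonneg_of_closed {A : Type*} [CStarAlgebra A] [PartialOrder A]
    [StarOrderedRing A] {M : StarSubalgebra ℂ A} (hM : IsClosed (M : Set A))
    {φ : M →ₗ[ℂ] ℂ} (hφ : IsPositiveFunctional φ) {a : M} (ha : 0 ≤ (a : A)) : 0 ≤ φ a := by
  have hs : CFC.sqrt (a : A) ∈ M := by
    rw [CFC.sqrt_eq_real_sqrt (a : A) ha, cfcₙ_eq_cfc]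
    exact cfc_mem (hs := hM) _ a.2
  convert! hφ ⟨_, hs⟩
  ext
  simpa [(CFC.sqrt_nonneg (a : A)).isSelfAdjoint.star_eq] using
    (CFC.sqrt_mul_sqrt_self (a : A) ha).symm

/-- A state on a closed star subalgebra extends to a state on the whole C⋆-algebra. -/
theorem IsState.exists_extension {A : Type*} [CStarAlgebra A] [PartialOrder A]
    [StarOrderedRing A] {M : StarSubalgebra ℂ A} (hM : IsClosed (M : Set A))
    {φ : M →ₗ[ℂ] ℂ} (hφ : IsState φ) :
    ∃ ψ : A →ₗ[ℂ] ℂ, IsState ψ ∧ ∀ a : M, ψ a = φ a := by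
  -- The cone of elements with positive real part. Using it with `Re φ`, the Riesz theorem applies
  -- to all of `A` as a real space, not only to the self-adjoint elements.
  let s : PointedCone ℝ A :=
    { carrier := {a | 0 ≤ a + star a}
      zero_mem' := by simp
      add_mem' := fun {a b} ha hb => by
        have := add_nonneg (Set.mem_ofPred_eq ▸ ha) (Set.mem_ofPred_eq ▸ hb)
        simpa [add_add_add_comm] using this
      smul_mem' := fun c a ha => by
        have : 0 ≤ (c : ℝ) • (a + star a) := smul_nonneg c.2 ha
        change 0 ≤ (c : ℝ) • a + star ((c : ℝ) • a)
        rwa [star_smul, star_trivial, ← smul_add] }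
  have hs (a : A) : a ∈ s ↔ 0 ≤ a + star a := Iff.rfl
  let f : A →ₗ.[ℝ] ℝ :=
    ⟨M.toSubalgebra.toSubmodule.restrictScalars ℝ,
      Complex.reLm.comp (φ.restrictScalars ℝ)⟩
  have im_zero (a : M) (ha : IsSelfAdjoint (a : A)) : (φ a).im = 0 := by
    have h : 0 ≤ φ (a + (‖(a : A)‖ : ℂ) • 1) := by
      refine hφ.positive.nonneg_of_closed hM ?_
      have := ha.neg_algebraMap_norm_le_self
      rw [neg_le_iff_add_nonneg] at this
      simpa [Algebra.algebraMap_eq_smul_one] using this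
    simpa [hφ.map_one] using (Complex.nonneg_iff.1 h).2.symm
  have re_star (a : M) (ha : 0 ≤ (a : A) + star (a : A)) : 0 ≤ (φ a).re := by
    have h1 : 0 ≤ φ (a + star a) := hφ.positive.nonneg_of_closed hM ha
    have h2 := im_zero (Complex.I • (a - star a)) (by
      simp [IsSelfAdjoint, smul_sub, neg_add_eq_sub])
    have h3 := (Complex.nonneg_iff.1 h1).1
    simp at h2 h3
    linarith
  obtain ⟨g, hgf, hg⟩ := riesz_extension s f
    (fun x hx => by
      exact re_star ⟨x.1, x.2⟩ hx)
    -- Cofinality: adding the scalar `‖y + y⋆‖` of `M` moves `y` into the cone.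
    (fun y => by
      refine ⟨⟨algebraMap ℝ A ‖y + star y‖, ?_⟩, ?_⟩
      · rw [IsScalarTower.algebraMap_apply ℝ ℂ A]
        exact M.algebraMap_mem _
      · have := (IsSelfAdjoint.add_star_self y).neg_algebraMap_norm_le_self
        rw [neg_le_iff_add_nonneg] at this
        have h0 : 0 ≤ algebraMap ℝ A ‖y + star y‖ := algebraMap_nonneg A (norm_nonneg _)
        rw [hs, star_add, ← algebraMap_star_comm, star_trivial ‖y + star y‖]
        convert! add_nonneg this h0 using 1
        abel)
  -- For skew-adjoint `a` both `a` and `-a` lie in the cone. This makes the complexification of `g`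
  -- real on `a⋆ a`.
  have hskew (a : A) (ha : star a = -a) : g a = 0 :=
    le_antisymm (by simpa using hg (-a) (by simp [hs, ha])) (hg a (by simp [hs, ha]))
  have hψ (a : A) : Module.Dual.extendRCLike (𝕜 := ℂ) g a = g a - Complex.I * g (Complex.I • a) :=
    Module.Dual.extendRCLike_apply ..
  have hext (a : M) : Module.Dual.extendRCLike (𝕜 := ℂ) g a = φ a := by
    have h1 : g a = (φ a).re := hgf ⟨a, a.2⟩
    have h2 : g (Complex.I • (a : A)) = (φ (Complex.I • a)).re :=
      hgf ⟨Complex.I • (a : A), (Complex.I • a).2⟩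
    rw [hψ, h1, h2]
    apply Complex.ext <;> simp
  refine ⟨Module.Dual.extendRCLike g, ⟨fun a => ?_, ?_⟩, hext⟩
  · rw [hψ, hskew (Complex.I • (star a * a)) (by simp)]
    have : 0 ≤ g (star a * a) := hg _ (by
      simpa [hs] using add_nonneg (star_mul_self_nonneg a) (star_mul_self_nonneg a))
    simpa using this
  · exact (hext 1).trans hφ.map_one

end Extension

theorem qA_subset_qcA (m k : ℕ) (B : Type u) [CStarAlgebra B] : qA m k B ⊆ qcA m k B := by
  rintro σ ⟨hσ, H, _, _, _, K, _, _, _, π, P, φ, hπ, hP, hφ, h⟩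
  -- If `H` were trivial then `1 = 0`, against `φ 1 = 1`. Faithfulness of `T ↦ 1 ⊗ T` needs a
  -- nonzero vector of `H`.
  have : Nontrivial H := by
    by_contra hH
    rw [not_nontrivial_iff_subsingleton] at hH
    have h1 : (1 : minTensor H π) = 0 := by
      ext1
      exact HilbertTensor.ext fun x y => by simp [Subsingleton.elim x 0]
    simpa [h1] using hφ.map_one
  obtain ⟨ψ, hψ, hψφ⟩ := hφ.exists_extension (M := minTensor H π) (StarSubalgebra.isClosed_topologicalClosure _)
  refine ⟨hσ, HilbertTensor H K, inferInstance, inferInstance, inferInstance,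
    (oneTensor H K).comp π, fun x a => opTensor (P x a) 1, ψ,
    oneTensor_injective.comp hπ, opTensor_isPVM hP, fun x a => ?_, hψ, fun x a b => ?_⟩
  · rintro _ ⟨b, rfl⟩
    change opTensor 1 (π b) * opTensor (P x a) 1 = opTensor (P x a) 1 * opTensor 1 (π b)
    simp [opTensor_mul]
  · refine (h x a b).trans ((hψφ _).symm.trans (congrArg ψ ?_))
    change opTensor (P x a) (π b) = opTensor (P x a) 1 * opTensor 1 (π b)
    simp [opTensor_mul]

/-! ### Weak-star limits of states. -/

section Limit

/-- The factor 4 counts the positive parts of `a`, each of norm at most `‖a‖`. Only a bound uniform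
in `φ` matters, for compactness. -/
theorem IsState.norm_apply_le {A : Type*} [CStarAlgebra A] [PartialOrder A]
    [StarOrderedRing A] {φ : A →ₗ[ℂ] ℂ} (hφ : IsState φ) (a : A) : ‖φ a‖ ≤ 4 * ‖a‖ := by
  let f : A →ₚ[ℂ] ℂ :=
    { φ with
      monotone' := fun a b hab => by
        simpa using hφ.positive.nonneg (sub_nonneg.2 hab) }
  have hf (a : A) : f a = φ a := rfl
  obtain ⟨y, hy0, hy, h⟩ := CStarAlgebra.exists_sum_four_nonneg a
  have key (i : Fin 4) : ‖Complex.I ^ (i : ℕ) * φ (y i)‖ ≤ ‖a‖ := by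
    have := f.norm_apply_le_of_nonneg (y i) (hy0 i)
    rw [hf, hf, hφ.map_one] at this
    simpa using this.trans (by simpa using hy i)
  calc ‖φ a‖ = ‖∑ i : Fin 4, Complex.I ^ (i : ℕ) * φ (y i)‖ := by
        conv_lhs => rw [h]
        simp only [map_sum, map_smul, smul_eq_mul]
    _ ≤ ∑ i : Fin 4, ‖a‖ := norm_sum_le_of_le _ fun i _ => key i
    _ = 4 * ‖a‖ := by simp

/-- A sequence of states has a limit state along an ultrafilter. -/
theorem exists_isState_of_seq {A : Type*} [CStarAlgebra A] [PartialOrder A]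
    [StarOrderedRing A] {φ : ℕ → A →ₗ[ℂ] ℂ} (hφ : ∀ n, IsState (φ n)) :
    ∃ ψ : A →ₗ[ℂ] ℂ, IsState ψ ∧
      ∀ a c, Tendsto (fun n => φ n a) atTop (𝓝 c) → ψ a = c := by
  have hlim (a : A) : ∃ c, Tendsto (fun n => φ n a) (hyperfilter ℕ) (𝓝 c) := by
    obtain ⟨c, -, hc⟩ := (isCompact_closedBall (0 : ℂ) (4 * ‖a‖)).ultrafilter_le_nhds
      ((hyperfilter ℕ).map fun n => φ n a)
      (le_principal_iff.2 (Ultrafilter.mem_coe.2 (Ultrafilter.mem_map.2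
        (univ_mem' fun n => by simpa using (hφ n).norm_apply_le a))))
    exact ⟨c, hc⟩
  choose ψ hψ using hlim
  let ψ' : A →ₗ[ℂ] ℂ :=
    { toFun := ψ
      map_add' := fun a b => tendsto_nhds_unique (hψ (a + b)) (by
        simpa using (hψ a).add (hψ b))
      map_smul' := fun c a => tendsto_nhds_unique (hψ (c • a)) (by
        simpa using (hψ a).const_mul c) }
  have hlim {a c} (h : Tendsto (fun n => φ n a) atTop (𝓝 c)) : ψ' a = c :=
    tendsto_nhds_unique (hψ a) (h.mono_left Nat.hyperfilter_le_atTop)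
  exact ⟨ψ', ⟨fun a => ge_of_tendsto' (hψ _) fun n => (hφ n).positive a,
    hlim (by simp [(hφ _).map_one])⟩, fun a c => hlim⟩

end Limit

/-! ### Compression of `S ⊗ T` by a column operator. -/

section Compression

variable {H K : Type*} [NormedAddCommGroup H] [InnerProductSpace ℂ H]
  [NormedAddCommGroup K] [InnerProductSpace ℂ K]

/-- The operator `y ↦ x ⊗ y` from `K` to `H ⊗ K`. -/
def tmulLeft (K : Type*) [NormedAddCommGroup K] [InnerProductSpace ℂ K] (x : H) :
    K →L[ℂ] HilbertTensor H K :=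
  (HilbertTensor.of H K).toContinuousLinearMap ∘L TensorProduct.mkL ℂ H K x

theorem tmulLeft_apply (x : H) (y : K) :
    tmulLeft K x y = HilbertTensor.of H K (x ⊗ₜ[ℂ] y) := rfl

variable [CompleteSpace K]

theorem adjoint_tmulLeft_comp (x x' : H) (S : H →L[ℂ] H) (T : K →L[ℂ] K) :
    (tmulLeft K x).adjoint ∘L opTensor S T ∘L tmulLeft K x' = inner ℂ x (S x') • T := by
  ext y
  refine ext_inner_left ℂ fun z => ?_
  simp [ContinuousLinearMap.adjoint_inner_right, tmulLeft_apply, opTensor_of_tmul,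
    inner_smul_right]

/-- The operator `y ↦ ∑ j < N, e j ⊗ W j y`. -/
def columnOp (e : ℕ → H) (W : ℕ → (K →L[ℂ] K)) (N : ℕ) : K →L[ℂ] HilbertTensor H K :=
  ∑ j ∈ Finset.range N, tmulLeft K (e j) ∘L W j

/-- The `(i, j)` term is `⟪e i, S (e j)⟫ • W i⋆ T W j`, so orthonormality leaves only `i = σ j`,
which is lost when it falls outside the range. -/
theorem adjoint_columnOp_comp {e : ℕ → H} (he : Orthonormal ℂ e) (W : ℕ → (K →L[ℂ] K)) (N : ℕ)
    {S : H →L[ℂ] H} {σ : ℕ → ℕ} (hS : ∀ j, S (e j) = e (σ j)) (T : K →L[ℂ] K) :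
    (columnOp e W N).adjoint ∘L opTensor S T ∘L columnOp e W N =
      ∑ j ∈ Finset.range N, if σ j < N then star (W (σ j)) * T * W j else 0 := by
  have key (i j : ℕ) : (tmulLeft K (e i) ∘L W i).adjoint ∘L opTensor S T ∘L
      (tmulLeft K (e j) ∘L W j) = if i = σ j then star (W (σ j)) * T * W j else 0 := by
    have h := adjoint_tmulLeft_comp (e i) (e j) S T
    rw [hS, orthonormal_iff_ite.1 he] at h
    calc _ = star (W i) * ((tmulLeft K (e i)).adjoint ∘L opTensor S T ∘L tmulLeft K (e j)) *
          W j := by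
          rw [ContinuousLinearMap.adjoint_comp]; rfl
      _ = _ := by rw [h]; split_ifs with hij <;> simp [hij]
  simp only [columnOp, map_sum, ContinuousLinearMap.finsetSum_comp,
    ContinuousLinearMap.comp_finsetSum, key]
  simp

end Compression

/-! ### Alternating words and reflections of the half-line. -/

section Dihedral

/-- The involution of `ℕ` that exchanges `j` and `j + 1` for all `j` of the parity of `x`. -/
def pairFlip (x : Fin 2) (j : ℕ) : ℕ := if j % 2 = x then j + 1 else j - 1

theorem pairFlip_involutive (x : Fin 2) : Function.Involutive (pairFlip x) := by
  intro j
  have := x.2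
  unfold pairFlip
  split_ifs <;> omega

theorem pairFlip_le (x : Fin 2) (j : ℕ) : pairFlip x j ≤ j + 1 := by
  unfold pairFlip
  split_ifs <;> omega

variable {A : Type*} [Ring A]

/-- The alternating words `1, U 0, U 0 * U 1, U 0 * U 1 * U 0, …`. -/
def altWord (U : Fin 2 → A) : ℕ → A
  | 0 => 1
  | j + 1 => altWord U j * U (Fin.ofNat 2 j)

theorem altWord_commute {U : Fin 2 → A} {T : A} (hT : ∀ x, Commute T (U x)) (j : ℕ) :
    Commute T (altWord U j) := by
  induction j with
  | zero => exact Commute.one_right T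
  | succ j ih => exact ih.mul_right (hT _)

variable [StarRing A] {U : Fin 2 → A} (hU : ∀ x, IsSelfAdjoint (U x)) (hU2 : ∀ x, U x * U x = 1)
include hU hU2

theorem star_altWord_mul_self (j : ℕ) : star (altWord U j) * altWord U j = 1 := by
  induction j with
  | zero => simp [altWord]
  | succ j ih =>
    rw [altWord, star_mul, (hU _).star_eq, mul_assoc, ← mul_assoc (star _), ih, one_mul, hU2]

/-- Neighbouring words differ by one last letter, and the parity of the edge says which. The
endpoint `j = 0` is excluded: truncated subtraction makes `pairFlip 1 0 = 0`, where the product is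
`1` instead of `U 1`. -/
theorem star_altWord_pairFlip_mul (x : Fin 2) {j : ℕ} (hj : j ≠ 0) :
    star (altWord U (pairFlip x j)) * altWord U j = U x := by
  have hx (i : ℕ) (hi : i % 2 = x) : Fin.ofNat 2 i = x := Fin.ext hi
  by_cases h : j % 2 = x
  · rw [pairFlip, if_pos h, altWord, star_mul, (hU _).star_eq, mul_assoc,
      star_altWord_mul_self hU hU2, mul_one, hx j h]
  · obtain ⟨i, rfl⟩ := Nat.exists_eq_succ_of_ne_zero hj
    have hi : i % 2 = x := by have := x.2; omega
    rw [pairFlip, if_neg h, Nat.succ_eq_add_one, Nat.add_sub_cancel, altWord, ← mul_assoc,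
      star_altWord_mul_self hU hU2, one_mul, hx i hi]

omit hU hU2

/-- A Hilbert space with an orthonormal sequence that is permuted by self-adjoint unitaries. -/
theorem exists_orthonormal_pairFlip : ∃ (H : Type u) (_ : NormedAddCommGroup H)
    (_ : InnerProductSpace ℂ H) (_ : CompleteSpace H) (e : ℕ → H) (S : Fin 2 → (H →L[ℂ] H)),
    Orthonormal ℂ e ∧ (∀ x, IsSelfAdjoint (S x)) ∧ (∀ x, S x * S x = 1) ∧
      ∀ x j, S x (e j) = e (pairFlip x j) := by
  let b : HilbertBasis (ULift.{u} ℕ) ℂ (lp (fun _ : ULift.{u} ℕ => ℂ) 2) :=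
    ⟨LinearIsometryEquiv.refl ℂ _⟩
  let τ (x : Fin 2) (i : ULift.{u} ℕ) : ULift.{u} ℕ := ⟨pairFlip x i.down⟩
  have hτ (x : Fin 2) : Function.Involutive (τ x) := fun i => ULift.ext _ _ (pairFlip_involutive x _)
  let b' (x : Fin 2) : HilbertBasis (ULift.{u} ℕ) ℂ (lp (fun _ : ULift.{u} ℕ => ℂ) 2) :=
    HilbertBasis.mk (b.orthonormal.comp _ (hτ x).injective) (by
      rw [(hτ x).surjective.range_comp, b.dense_span])
  let L (x : Fin 2) := b.repr.trans (b' x).repr.symm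
  let S (x : Fin 2) : _ →L[ℂ] _ := (L x).toContinuousLinearEquiv.toContinuousLinearMap
  have hS (x : Fin 2) (i : ULift.{u} ℕ) : S x (b i) = b (τ x i) := by
    classical
    change (b' x).repr.symm (b.repr (b i)) = _
    rw [b.repr_self, (b' x).repr_symm_single]
    simp [b']
  have hS2 (x : Fin 2) : S x * S x = 1 := by
    refine ContinuousLinearMap.ext_on
      (Submodule.dense_iff_topologicalClosure_eq_top.2 b.dense_span) ?_
    rintro _ ⟨i, rfl⟩
    simp [hS, hτ x i]
  have hadj (x : Fin 2) : star (S x) * S x = 1 := by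
    rw [ContinuousLinearMap.star_eq_adjoint]
    exact (ContinuousLinearMap.norm_map_iff_adjoint_comp_self _).1 (L x).norm_map
  refine ⟨_, inferInstance, inferInstance, inferInstance, fun j => b ⟨j⟩, S,
    b.orthonormal.comp _ ULift.up_injective, fun x => ?_, hS2, fun x j => hS x ⟨j⟩⟩
  -- A unitary that is its own inverse is self-adjoint.
  exact left_inv_eq_right_inv (hadj x) (hS2 x)

end Dihedral

/-! ### Averaged states and their limits. -/

section Average

variable {H K : Type*} [NormedAddCommGroup H] [InnerProductSpace ℂ H]
  [NormedAddCommGroup K] [InnerProductSpace ℂ K] [CompleteSpace K]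

/-- The functional `T ↦ φ (V⋆ T V) / (n + 1)` for the column operator `V` of length `n + 1`. -/
def averageFunctional (e : ℕ → H) (W : ℕ → (K →L[ℂ] K)) (φ : (K →L[ℂ] K) →ₗ[ℂ] ℂ) (n : ℕ) :
    (HilbertTensor H K →L[ℂ] HilbertTensor H K) →ₗ[ℂ] ℂ where
  toFun T := ((n + 1 : ℕ) : ℂ)⁻¹ *
    φ ((columnOp e W (n + 1)).adjoint ∘L T ∘L columnOp e W (n + 1))
  map_add' S T := by
    simp [ContinuousLinearMap.add_comp, ContinuousLinearMap.comp_add, mul_add]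
  map_smul' c T := by
    simp [ContinuousLinearMap.smul_comp, mul_left_comm]

theorem averageFunctional_opTensor {e : ℕ → H} (he : Orthonormal ℂ e) (W : ℕ → (K →L[ℂ] K))
    (φ : (K →L[ℂ] K) →ₗ[ℂ] ℂ) (n : ℕ) {S : H →L[ℂ] H} {σ : ℕ → ℕ}
    (hS : ∀ j, S (e j) = e (σ j)) (T : K →L[ℂ] K) :
    averageFunctional e W φ n (opTensor S T) = ((n + 1 : ℕ) : ℂ)⁻¹ *
      ∑ j ∈ Finset.range (n + 1), if σ j < n + 1 then φ (star (W (σ j)) * T * W j) else 0 := by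
  change _ * φ _ = _
  rw [adjoint_columnOp_comp he W (n + 1) hS T, map_sum]
  simp only [apply_ite φ, map_zero]

theorem averageFunctional_one_tensor {e : ℕ → H} (he : Orthonormal ℂ e) {W : ℕ → (K →L[ℂ] K)}
    (hW : ∀ j, star (W j) * W j = 1) (φ : (K →L[ℂ] K) →ₗ[ℂ] ℂ) (n : ℕ) {T : K →L[ℂ] K}
    (hT : ∀ j, Commute T (W j)) :
    averageFunctional e W φ n (opTensor 1 T) = φ T := by
  rw [averageFunctional_opTensor he W φ n (σ := id) (fun _ => rfl)]
  have h (j : ℕ) : star (W j) * T * W j = T := by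
    rw [mul_assoc, (hT j).eq, ← mul_assoc, hW, one_mul]
  rw [Finset.sum_congr rfl fun j hj => by rw [id, if_pos (Finset.mem_range.1 hj), h]]
  rw [Finset.sum_const, Finset.card_range, nsmul_eq_mul, inv_mul_cancel_left₀]
  exact Nat.cast_ne_zero.2 n.succ_ne_zero

theorem averageFunctional_isState {e : ℕ → H} (he : Orthonormal ℂ e) {W : ℕ → (K →L[ℂ] K)}
    (hW : ∀ j, star (W j) * W j = 1) {φ : (K →L[ℂ] K) →ₗ[ℂ] ℂ} (hφ : IsState φ) (n : ℕ) :
    IsState (averageFunctional e W φ n) where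
  positive T := by
    refine mul_nonneg (by positivity) (hφ.positive.nonneg ?_)
    rw [ContinuousLinearMap.nonneg_iff_isPositive]
    have := (ContinuousLinearMap.nonneg_iff_isPositive _).1 (star_mul_self_nonneg T)
    exact this.adjoint_conj _
  map_one := by
    rw [← opTensor_one, averageFunctional_one_tensor he hW φ n fun j => Commute.one_left _,
      hφ.map_one]

theorem tendsto_averageFunctional {e : ℕ → H} (he : Orthonormal ℂ e) {W : ℕ → (K →L[ℂ] K)}
    (φ : (K →L[ℂ] K) →ₗ[ℂ] ℂ) {S : H →L[ℂ] H} {σ : ℕ → ℕ}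
    (hS : ∀ j, S (e j) = e (σ j)) (hσ : ∀ j, σ j ≤ j + 1) {T : K →L[ℂ] K} {c : ℂ}
    (hc : ∀ j ≠ 0, φ (star (W (σ j)) * T * W j) = c) :
    Tendsto (fun n => averageFunctional e W φ n (opTensor S T)) atTop (𝓝 c) := by
  set a : ℕ → ℂ := fun j => φ (star (W (σ j)) * T * W j) with ha
  -- Since `σ j ≤ j + 1`, only the last index `n` can be sent out of the range; `r n` is the term
  -- then missing from the full Cesàro sum.
  let r : ℕ → ℂ := fun n => if σ n < n + 1 then 0 else a n
  have hsum (n : ℕ) : averageFunctional e W φ n (opTensor S T) =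
      ((n + 1 : ℕ) : ℂ)⁻¹ * ∑ j ∈ Finset.range (n + 1), a j - ((n + 1 : ℕ) : ℂ)⁻¹ * r n := by
    rw [averageFunctional_opTensor he W φ n hS, Finset.sum_range_succ, Finset.sum_range_succ,
      Finset.sum_congr rfl fun j hj => if_pos (by have := hσ j; have := Finset.mem_range.1 hj; omega)]
    simp only [r]
    split_ifs <;> ring
  have h1 : Tendsto (fun n : ℕ => ((n + 1 : ℕ) : ℂ)⁻¹ * ∑ j ∈ Finset.range (n + 1), a j) atTop
      (𝓝 c) := by
    -- The possibly different value `a 0` does not affect the limit.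
    have ha : Tendsto a atTop (𝓝 c) := tendsto_const_nhds.congr'
      ((eventually_ne_atTop 0).mono fun j hj => (hc j hj).symm)
    have := (tendsto_add_atTop_iff_nat 1).2 ha.cesaro_smul
    simpa using this
  have h2 : Tendsto (fun n : ℕ => ((n + 1 : ℕ) : ℂ)⁻¹ * r n) atTop (𝓝 0) := by
    have h0 : Tendsto (fun n : ℕ => ((n + 1 : ℕ) : ℂ)⁻¹) atTop (𝓝 0) :=
      (tendsto_add_atTop_iff_nat 1).2 (tendsto_inv_atTop_nhds_zero_nat (𝕜 := ℂ))
    refine h0.zero_mul_isBoundedUnder_le ⟨‖c‖, ?_⟩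
    rw [eventually_map]
    filter_upwards [eventually_ne_atTop 0] with n hn
    simp only [Function.comp, r]
    split_ifs
    · simp
    · exact (congrArg norm (hc n hn)).le
  simpa only [hsum, sub_zero] using h1.sub h2

end Average

/-! ### Two-outcome PVMs as self-adjoint unitaries. -/

section Binary

theorem isStarProjection_half_smul {A : Type*} [Ring A] [StarRing A] [Algebra ℂ A]
    [StarModule ℂ A] {U : A} (hU : IsSelfAdjoint U) (hU2 : U * U = 1) :
    IsStarProjection ((2⁻¹ : ℂ) • (1 + U)) where
  isIdempotentElem := by
    have : (1 + U) * (1 + U) = (2 : ℂ) • (1 + U) := by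
      rw [mul_add, add_mul, add_mul, hU2, two_smul]; simp only [one_mul, mul_one]; abel
    rw [IsIdempotentElem, smul_mul_smul_comm, this, smul_smul]
    norm_num
  isSelfAdjoint := by simp [IsSelfAdjoint, hU.star_eq]

/-- The PVMs with two outcomes given by self-adjoint unitaries. -/
def binaryPVM {A : Type*} [Ring A] [Algebra ℂ A] {m : ℕ} (U : Fin m → A) (x : Fin m)
    (a : Fin 2) : A :=
  (2⁻¹ : ℂ) • (1 + (![1, -1] a : ℂ) • U x)

theorem binaryPVM_isPVM {A : Type*} [Ring A] [StarRing A] [Algebra ℂ A] [StarModule ℂ A] {m : ℕ}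
    {U : Fin m → A} (hU : ∀ x, IsSelfAdjoint (U x)) (hU2 : ∀ x, U x * U x = 1) :
    IsPVM (binaryPVM U) where
  isStarProjection x a := by
    refine isStarProjection_half_smul ?_ ?_ <;> fin_cases a
    · simpa using hU x
    · simpa using (hU x).neg
    · simpa using hU2 x
    · simpa using hU2 x
  sum_eq_one x := by
    simp only [Fin.sum_univ_two, binaryPVM, Matrix.cons_val_zero, Matrix.cons_val_one]
    module

/-- Writes `P x a` as a linear combination of `1` and `U x`, so an assemblage is determined by the
values of the state on these two, multiplied by `π b`. -/
theorem IsPVM.eq_binaryPVM {A : Type*} [Ring A] [StarRing A] [Algebra ℂ A] {m : ℕ}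
    {P : Fin m → Fin 2 → A} (hP : IsPVM P) : P = binaryPVM fun x => P x 0 - P x 1 := by
  ext x a
  have h := hP.sum_eq_one x
  rw [Fin.sum_univ_two] at h
  simp only [binaryPVM, ← h]
  fin_cases a <;> simp <;> module

theorem IsPVM.sub_mul_sub {A : Type*} [Ring A] [StarRing A] {m : ℕ}
    {P : Fin m → Fin 2 → A} (hP : IsPVM P) (x : Fin m) :
    (P x 0 - P x 1) * (P x 0 - P x 1) = 1 := by
  have h := hP.sum_eq_one x
  rw [Fin.sum_univ_two, ← eq_sub_iff_add_eq'] at h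
  have h0 := (hP.isStarProjection x 0).isIdempotentElem.eq
  rw [h]
  noncomm_ring
  simp [h0]

end Binary

theorem qcA_subset_qA (B : Type u) [CStarAlgebra B] : qcA 2 2 B ⊆ qA 2 2 B := by
  rintro σ ⟨hσ, K, _, _, _, π, P, φ, hπ, hP, hcomm, hφ, h⟩
  obtain ⟨H, _, _, _, e, S, he, hS, hS2, hSe⟩ := exists_orthonormal_pairFlip.{u}
  set U : Fin 2 → (K →L[ℂ] K) := fun x => P x 0 - P x 1 with hUdef
  have hU (x : Fin 2) : IsSelfAdjoint (U x) :=
    (hP.isStarProjection x 0).isSelfAdjoint.sub (hP.isStarProjection x 1).isSelfAdjoint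
  have hU2 (x : Fin 2) : U x * U x = 1 := hP.sub_mul_sub x
  have hπU (b : B) (x : Fin 2) : Commute (π b) (U x) :=
    (show Commute (π b) (P x 0) from hcomm x 0 _ ⟨b, rfl⟩).sub_right (hcomm x 1 _ ⟨b, rfl⟩)
  have hW := star_altWord_mul_self hU hU2
  have hπW (b : B) (j : ℕ) : Commute (π b) (altWord U j) := altWord_commute (hπU b) j
  obtain ⟨ψ, hψ, hψlim⟩ := exists_isState_of_seq (averageFunctional_isState he hW hφ)
  have hψ1 (b : B) : ψ (opTensor 1 (π b)) = φ (π b) := hψlim _ _ (by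
    simpa only [averageFunctional_one_tensor he hW φ _ (hπW b)] using tendsto_const_nhds)
  have hψS (x : Fin 2) (b : B) : ψ (opTensor (S x) (π b)) = φ (U x * π b) := by
    -- `π b` moves past `W j`, leaving `W (σ j)⋆ W j = U x` for `j ≠ 0`.
    refine hψlim _ _ (tendsto_averageFunctional he φ (hSe x) (pairFlip_le x) fun j hj => ?_)
    rw [mul_assoc, (hπW b j).eq, ← mul_assoc, star_altWord_pairFlip_mul hU hU2 x hj]
  refine ⟨hσ, H, inferInstance, inferInstance, inferInstance, K, inferInstance, inferInstance,
    inferInstance, π, binaryPVM S, ψ ∘ₗ (minTensor H π).subtype.toLinearMap, hπ,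
    binaryPVM_isPVM hS hS2, ⟨fun a => hψ.positive a, hψ.map_one⟩, fun x a b => ?_⟩
  change σ x a b = ψ (opTensor (binaryPVM S x a) (π b))
  rw [h, hP.eq_binaryPVM]
  simp only [binaryPVM, opTensor_smul_left, opTensor_add_left, map_smul, map_add, smul_mul_assoc,
    add_mul, one_mul, hψ1, hψS, U]

end Steering

end

theorem mainTheorem7 (B : Type u) [CStarAlgebra B] :
    Steering.qA 2 2 B = Steering.qcA 2 2 B :=
  (Steering.qA_subset_qcA 2 2 B).antisymm (Steering.qcA_subset_qA B)
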